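/- A \emph{topological $*$-algebra} is an associative (not necessarily unital) algebra $A$ over $\mathbb{C}$ with an involution satisfying $(a+\lambda b)^*=a^*+\bar\lambda b^*$ and $(ab)^*=b^*a^*$, equipped with a topology for which addition, multiplication, additive inverse and involution are continuous. Let $\mathcal{N}(A)$ be the set of continuous $C^*$-seminorms on $A$, i.e. continuous seminorms $p$ with $p(ab)\le p(a)p(b)$ and $p(a^*a)=p(a)^2$, ordered pointwise. Call $A$ a \emph{(generalized) $G^*$-algebra} if $\gamma(x)=\sup\{p(x)\mid p\in\mathcal{N}(A)\}<\infty$ for every $x\in A$ and $\gamma$ is continuous on $A$. For $p\in\mathcal{N}(A)$ let $A_p$ be the $C^*$-algebra obtained by completing $A/\ker p$ in the norm induced by $p$. The \emph{enveloping $C^*$-algebra} of a $G^*$-algebra $A$ is $C^*(A)=\lim_{p\in\mathcal{N}(A)}A_p$, the $*$-algebra of families $(x_p)_p\in\prod_p A_p$ that are compatible with the canonical morphisms $A_q\to A_p$ ($p\le q$), with the topology induced by the product; the canonical map is $\alpha_A\colon A\to C^*(A)$, $\alpha_A(x)=(x+\ker p)_{p}$. The \emph{$*$-representation topology} $\mathcal{T}_A$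 on $A$ is the initial topology for all continuous $*$-homomorphisms $A\to B(H)$, where $H$ is any complex Hilbert space and $B(H)$ carries the norm topology. For a $*$-subalgebra $S\subseteq A$ (or its underlying set) let $c^*_A(S)$ be its closure in $\mathcal{T}_A$. A $G^*$-algebra $A$ is \emph{$c^*$-compact} if for every $G^*$-algebra $Y$, with $\pi_Y\colon A\times Y\to Y$ the projection, $$\pi_Y\big(c^*_{A\times Y}(M)\big)=c^*_Y\big(\pi_Y(M)\big)$$ for every subobject $M$ of $A\times Y$, i.e. every $*$-subalgebra $M$ of $A\times Y$ that is itself a $G^*$-algebra in the subspace topology. \textbf{Theorem.} A $G^*$-algebra $A$ is $c^*$-compact if and only if $\alpha_A\colon A\to C^*(A)$ is surjective. The same equivalence holds if, in the definition of $c^*$-compactness, $M$ is allowed to be an arbitrary $*$-subalgebra of $A\times Y$. -/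

import Mathlib

open Filter Topology

universe u

noncomputable section

namespace TopStarAlg

/-! Throughout, a topological `*`-algebra is an associative complex algebra, not necessarily unital,
with a conjugate-linear involution reversing products, and with a topology for which addition,
multiplication, additive inverse and involution are continuous. -/

/-- The set `N(A)` of continuous `C*`-seminorms on `A`. -/
structure ContCStarSeminorm (A : Type u) [NonUnitalRing A] [StarRing A] [Module ℂ A]
    [TopologicalSpace A] extends Seminorm ℂ A where
  mul_le' : ∀ a b : A, toSeminorm (a * b) ≤ toSeminorm a * toSeminorm b
  cstar' : ∀ a : A, toSeminorm (star a * a) = toSeminorm a ^ 2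
  continuous' : Continuous fun a : A => toSeminorm a

section Defs

variable {A : Type u} [NonUnitalRing A] [StarRing A] [Module ℂ A] [TopologicalSpace A]

instance : CoeFun (ContCStarSeminorm A) fun _ => A → ℝ := ⟨fun p => p.toSeminorm⟩

/-- The pointwise order on continuous `C*`-seminorms. -/
instance : LE (ContCStarSeminorm A) := ⟨fun p q => ∀ a : A, p a ≤ q a⟩

theorem ContCStarSeminorm.le_star (p : ContCStarSeminorm A) (a : A) : p a ≤ p (star a) := by
  have h1 := p.mul_le' (star a) a
  rw [p.cstar' a] at h1
  have h0 : 0 ≤ p a := apply_nonneg p.toSeminorm a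
  have h2 : 0 ≤ p (star a) := apply_nonneg p.toSeminorm (star a)
  rcases h0.eq_or_lt with h | h
  · rw [← h]; exact h2
  · exact le_of_mul_le_mul_right (by nlinarith [h1]) h

theorem ContCStarSeminorm.map_star (p : ContCStarSeminorm A) (a : A) : p (star a) = p a := by
  refine le_antisymm ?_ (p.le_star a)
  simpa using p.le_star (star a)

variable (A) in
/-- `γ(x) = sup {p(x) | p ∈ N(A)}`. -/
def gamma (x : A) : ℝ := ⨆ p : ContCStarSeminorm A, p x

variable (A) in
/-- (Generalized) `G*`-algebras: `γ` is finite everywhere and continuous. -/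
def IsGStar : Prop :=
  (∀ x : A, BddAbove (Set.range fun p : ContCStarSeminorm A => p x)) ∧ Continuous (gamma A)

/-! ### The `C*`-algebra `A_p`: the Hausdorff completion of `(A, p)` -/

/-- The algebra `A`, to be seminormed by `p`. -/
def WithSeminorm (_p : ContCStarSeminorm A) : Type u := A

variable (p : ContCStarSeminorm A)

instance : NonUnitalRing (WithSeminorm p) := inferInstanceAs (NonUnitalRing A)
instance : StarRing (WithSeminorm p) := inferInstanceAs (StarRing A)
instance : Module ℂ (WithSeminorm p) := inferInstanceAs (Module ℂ A)
instance [IsScalarTower ℂ A A] : IsScalarTower ℂ (WithSeminorm p) (WithSeminorm p) :=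
  inferInstanceAs (IsScalarTower ℂ A A)
instance [SMulCommClass ℂ A A] : SMulCommClass ℂ (WithSeminorm p) (WithSeminorm p) :=
  inferInstanceAs (SMulCommClass ℂ A A)
instance [StarModule ℂ A] : StarModule ℂ (WithSeminorm p) := inferInstanceAs (StarModule ℂ A)

/-- The seminorm `p` on the additive group of `A`. -/
def WithSeminorm.seminorm : AddGroupSeminorm (WithSeminorm p) where
  toFun a := p a
  map_zero' := map_zero p.toSeminorm
  add_le' := map_add_le_add p.toSeminorm
  neg' := map_neg_eq_map p.toSeminorm

instance : SeminormedAddCommGroup (WithSeminorm p) :=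
  (WithSeminorm.seminorm p).toSeminormedAddCommGroup

theorem WithSeminorm.norm_def (a : WithSeminorm p) : ‖a‖ = p a := rfl

instance : NonUnitalSeminormedRing (WithSeminorm p) :=
  { (inferInstance : SeminormedAddCommGroup (WithSeminorm p)),
    (inferInstance : NonUnitalRing (WithSeminorm p)) with
    norm_mul_le := fun a b => p.mul_le' a b }

instance : NormedSpace ℂ (WithSeminorm p) where
  norm_smul_le c a := le_of_eq (map_smul_eq_mul p.toSeminorm c a)

instance : NormedStarGroup (WithSeminorm p) where
  norm_star_le a := le_of_eq (p.map_star a)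

/-- `A_p`: the completion of `A / ker p` for the norm induced by `p`, realised as the Hausdorff
completion of `A` seminormed by `p`. -/
def CompletionAt : Type u := UniformSpace.Completion (WithSeminorm p)

namespace CompletionAt

instance : NormedAddCommGroup (CompletionAt p) :=
  inferInstanceAs (NormedAddCommGroup (UniformSpace.Completion (WithSeminorm p)))
instance : NormedSpace ℂ (CompletionAt p) :=
  inferInstanceAs (NormedSpace ℂ (UniformSpace.Completion (WithSeminorm p)))
instance : CompleteSpace (CompletionAt p) :=
  inferInstanceAs (CompleteSpace (UniformSpace.Completion (WithSeminorm p)))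

/-- The canonical additive map from `A` to `A_p`. -/
def of : WithSeminorm p →+ CompletionAt p := UniformSpace.Completion.toCompl

theorem isDenseInducing_of : IsDenseInducing (of p) := UniformSpace.Completion.isDenseInducing_coe

theorem continuous_of : Continuous (of p) := (isDenseInducing_of p).continuous

theorem norm_of (a : WithSeminorm p) : ‖of p a‖ = p a := UniformSpace.Completion.norm_coe a

theorem of_smul (c : ℂ) (a : WithSeminorm p) : of p (c • a) = c • of p a :=
  UniformSpace.Completion.coe_smul c a

variable {p}

theorem ind {P : CompletionAt p → Prop} (x : CompletionAt p) (hc : IsClosed {x | P x})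
    (h : ∀ a, P (of p a)) : P x :=
  UniformSpace.Completion.induction_on x hc h

theorem ind₂ {P : CompletionAt p → CompletionAt p → Prop} (x y : CompletionAt p)
    (hc : IsClosed {z : CompletionAt p × CompletionAt p | P z.1 z.2})
    (h : ∀ a b, P (of p a) (of p b)) : P x y :=
  UniformSpace.Completion.induction_on₂ x y hc h

theorem ind₃ {P : CompletionAt p → CompletionAt p → CompletionAt p → Prop}
    (x y z : CompletionAt p)
    (hc : IsClosed {w : CompletionAt p × CompletionAt p × CompletionAt p | P w.1 w.2.1 w.2.2})
    (h : ∀ a b c, P (of p a) (of p b) (of p c)) : P x y z :=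
  UniformSpace.Completion.induction_on₃ x y z hc h

instance : Mul (CompletionAt p) where
  mul := Function.curry <| ((isDenseInducing_of p).prodMap (isDenseInducing_of p)).extend
    fun z => of p (z.1 * z.2)

theorem of_mul (a b : WithSeminorm p) : of p (a * b) = of p a * of p b :=
  (((isDenseInducing_of p).prodMap (isDenseInducing_of p)).extend_eq
    ((continuous_of p).comp continuous_mul) (a, b)).symm

instance : ContinuousMul (CompletionAt p) where
  continuous_mul := by
    let m := (AddMonoidHom.mul : WithSeminorm p →+ WithSeminorm p →+ WithSeminorm p).compr₂ (of p)
    have : Continuous fun z : WithSeminorm p × WithSeminorm p => m z.1 z.2 :=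
      (continuous_of p).comp continuous_mul
    exact ((isDenseInducing_of p).extend_Z_bilin (isDenseInducing_of p) this :)

instance : NonUnitalNormedRing (CompletionAt p) :=
  { (inferInstance : NormedAddCommGroup (CompletionAt p)),
    (inferInstance : Mul (CompletionAt p)) with
    zero_mul := fun x => by
      induction x using ind with
      | hc => exact isClosed_eq (by fun_prop) (by fun_prop)
      | h a =>
        rw [← map_zero (of p), ← of_mul, zero_mul]
    mul_zero := fun x => by
      induction x using ind with
      | hc => exact isClosed_eq (by fun_prop) (by fun_prop)
      | h a =>
        rw [← map_zero (of p), ← of_mul, mul_zero]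
    mul_assoc := fun x y z => by
      induction x, y, z using ind₃ with
      | hc => exact isClosed_eq (by fun_prop) (by fun_prop)
      | h a b c =>
        rw [← of_mul, ← of_mul, ← of_mul, ← of_mul, mul_assoc]
    left_distrib := fun x y z => by
      induction x, y, z using ind₃ with
      | hc => exact isClosed_eq (by fun_prop) (by fun_prop)
      | h a b c =>
        rw [← map_add, ← of_mul, ← of_mul, ← of_mul, ← map_add, mul_add]
    right_distrib := fun x y z => by
      induction x, y, z using ind₃ with
      | hc => exact isClosed_eq (by fun_prop) (by fun_prop)
      | h a b c =>
        rw [← map_add, ← of_mul, ← of_mul, ← of_mul, ← map_add, add_mul]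
    norm_mul_le := fun x y => by
      induction x, y using ind₂ with
      | hc => exact isClosed_le (by fun_prop) (by fun_prop)
      | h a b =>
        rw [← of_mul, norm_of, norm_of, norm_of]
        exact p.mul_le' a b }

instance : Star (CompletionAt p) where
  star := UniformSpace.Completion.map (star : WithSeminorm p → WithSeminorm p)

theorem uniformContinuous_star : UniformContinuous (star : WithSeminorm p → WithSeminorm p) :=
  star_isometry.uniformContinuous

theorem of_star (a : WithSeminorm p) : of p (star a) = star (of p a) :=
  (UniformSpace.Completion.map_coe uniformContinuous_star a).symm

instance : ContinuousStar (CompletionAt p) where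
  continuous_star := UniformSpace.Completion.continuous_map

instance : StarRing (CompletionAt p) where
  star_involutive x := by
    induction x using ind with
    | hc => exact isClosed_eq (by fun_prop) (by fun_prop)
    | h a =>
      rw [← of_star, ← of_star, star_star]
  star_mul x y := by
    induction x, y using ind₂ with
    | hc => exact isClosed_eq (by fun_prop) (by fun_prop)
    | h a b =>
      rw [← of_mul, ← of_star, ← of_star, ← of_star, ← of_mul, star_mul]
  star_add x y := by
    induction x, y using ind₂ with
    | hc => exact isClosed_eq (by fun_prop) (by fun_prop)
    | h a b =>
      rw [← map_add, ← of_star, ← of_star, ← of_star, ← map_add, star_add]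

instance : CStarRing (CompletionAt p) where
  norm_mul_self_le x := by
    induction x using ind with
    | hc => exact isClosed_le (by fun_prop) (by fun_prop)
    | h a =>
      rw [← of_star, ← of_mul, norm_of, norm_of, ← sq]
      exact (p.cstar' a).ge

instance [IsScalarTower ℂ A A] : IsScalarTower ℂ (CompletionAt p) (CompletionAt p) where
  smul_assoc c x y := by
    simp only [smul_eq_mul]
    induction x, y using ind₂ with
    | hc =>
      exact isClosed_eq (((continuous_const_smul c).comp continuous_fst).mul continuous_snd)
        ((continuous_const_smul c).comp continuous_mul)
    | h a b =>
      rw [← of_smul, ← of_mul, ← of_mul, ← of_smul, smul_mul_assoc]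

instance [SMulCommClass ℂ A A] : SMulCommClass ℂ (CompletionAt p) (CompletionAt p) where
  smul_comm c x y := by
    simp only [smul_eq_mul]
    induction x, y using ind₂ with
    | hc =>
      exact isClosed_eq ((continuous_const_smul c).comp continuous_mul)
        (continuous_fst.mul ((continuous_const_smul c).comp continuous_snd))
    | h a b =>
      rw [← of_smul, ← of_mul, ← of_mul, ← of_smul, mul_smul_comm]

instance [StarModule ℂ A] : StarModule ℂ (CompletionAt p) where
  star_smul c x := by
    induction x using ind with
    | hc =>
      exact isClosed_eq (continuous_star.comp (continuous_const_smul c))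
        ((continuous_const_smul (star c)).comp continuous_star)
    | h a =>
      rw [← of_smul, ← of_star, ← of_star, ← of_smul, star_smul]

/-- `A_p` is a `C*`-algebra. -/
instance [IsScalarTower ℂ A A] [SMulCommClass ℂ A A] [StarModule ℂ A] :
    NonUnitalCStarAlgebra (CompletionAt p) where

variable (p) in
/-- The canonical map `A → A_p` as a `*`-homomorphism. -/
def ofHom : A →⋆ₙₐ[ℂ] CompletionAt p where
  toFun a := of p a
  map_smul' c a := of_smul p c a
  map_zero' := map_zero (of p)
  map_add' a b := map_add (of p) a b
  map_mul' a b := of_mul (p := p) a b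
  map_star' a := of_star (p := p) a

variable {q : ContCStarSeminorm A}

theorem uniformContinuous_id (h : p ≤ q) :
    UniformContinuous (fun a : WithSeminorm q => (show WithSeminorm p from a)) := by
  refine AddMonoidHomClass.uniformContinuous_of_bound
    (AddMonoidHom.mk' (fun a : WithSeminorm q => (show WithSeminorm p from a))
      fun _ _ => rfl) 1 fun a => ?_
  rw [one_mul]
  exact h a

/-- For `p ≤ q`, the underlying function of the canonical morphism `A_q → A_p`: the continuous
extension of the identity of `A`. -/
def transFun (p q : ContCStarSeminorm A) : CompletionAt q → CompletionAt p :=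
  UniformSpace.Completion.map fun a : WithSeminorm q => (show WithSeminorm p from a)

theorem continuous_transFun : Continuous (transFun p q) := UniformSpace.Completion.continuous_map

theorem transFun_of (h : p ≤ q) (a : WithSeminorm q) : transFun p q (of q a) = of p a :=
  UniformSpace.Completion.map_coe (uniformContinuous_id h) a

/-- For `p ≤ q`, the canonical morphism `A_q → A_p`. -/
def transition (h : p ≤ q) : CompletionAt q →⋆ₙₐ[ℂ] CompletionAt p where
  toFun := transFun p q
  map_smul' c x := by
    have hc := continuous_transFun (p := p) (q := q)
    induction x using ind with
    | hc =>
      exact isClosed_eq (hc.comp (continuous_const_smul c))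
        ((continuous_const_smul c).comp hc)
    | h a =>
      rw [← of_smul, transFun_of h, transFun_of h]
      exact of_smul p c a
  map_zero' := by
    have := transFun_of h (0 : WithSeminorm q)
    exact (congrArg _ (map_zero (of q)).symm).trans (this.trans (map_zero (of p)))
  map_add' x y := by
    have hc := continuous_transFun (p := p) (q := q)
    induction x, y using ind₂ with
    | hc => exact isClosed_eq (by fun_prop) (by fun_prop)
    | h a b =>
      rw [← map_add, transFun_of h, transFun_of h, transFun_of h]
      exact map_add (of p) a b
  map_mul' x y := by
    have hc := continuous_transFun (p := p) (q := q)
    induction x, y using ind₂ with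
    | hc => exact isClosed_eq (by fun_prop) (by fun_prop)
    | h a b =>
      rw [← of_mul, transFun_of h, transFun_of h, transFun_of h]
      exact of_mul (p := p) a b
  map_star' x := by
    have hc := continuous_transFun (p := p) (q := q)
    induction x using ind with
    | hc => exact isClosed_eq (by fun_prop) (by fun_prop)
    | h a =>
      rw [← of_star, transFun_of h, transFun_of h]
      exact of_star (p := p) a

theorem transition_ofHom (h : p ≤ q) (a : A) : transition h (ofHom q a) = ofHom p a :=
  transFun_of h a

end CompletionAt

open CompletionAt

variable (A) in
/-- The limit `lim A_p` over the directed set `N(A)`, formed in topological `*`-algebras: the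
`*`-subalgebra of the product of all `A_p` consisting of the compatible families, with the
subspace topology of the product topology. For a `G*`-algebra `A` this is its enveloping
`C*`-algebra `C*(A)`. -/
def EnvelopingCStar : NonUnitalStarSubalgebra ℂ (∀ p : ContCStarSeminorm A, CompletionAt p) where
  carrier := {x | ∀ (p q : ContCStarSeminorm A) (h : p ≤ q), transition h (x q) = x p}
  add_mem' hx hy p q h := by simp [hx p q h, hy p q h]
  zero_mem' p q h := by simp
  mul_mem' hx hy p q h := by simp [hx p q h, hy p q h]
  smul_mem' c x hx p q h := by simp [hx p q h]
  star_mem' hx p q h := by simp [StarHomClass.map_star, hx p q h]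

variable (A) in
/-- The canonical map `α_A : A → C*(A)`, `x ↦ (x + ker p)_p`. -/
def alpha : A →⋆ₙₐ[ℂ] EnvelopingCStar A where
  toFun a := ⟨fun p => ofHom p a, fun _ _ h => transition_ofHom h a⟩
  map_smul' c a := Subtype.ext <| funext fun p => map_smul (ofHom p) c a
  map_zero' := Subtype.ext <| funext fun p => map_zero (ofHom p)
  map_add' a b := Subtype.ext <| funext fun p => map_add (ofHom p) a b
  map_mul' a b := Subtype.ext <| funext fun p => map_mul (ofHom p) a b
  map_star' a := Subtype.ext <| funext fun p => StarHomClass.map_star (ofHom p) a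

/-! ### The `*`-representation topology and compactness for the closure `c*` -/

variable (A) in
/-- The `*`-representation topology: the initial topology for all continuous
`*`-homomorphisms `A → B(H)`, `H` a complex Hilbert space. -/
abbrev repTopology : TopologicalSpace A :=
  ⨅ (H : Type u) (_ : NormedAddCommGroup H) (_ : InnerProductSpace ℂ H) (_ : CompleteSpace H)
    (π : A →⋆ₙₐ[ℂ] (H →L[ℂ] H)) (_ : Continuous π),
    TopologicalSpace.induced π inferInstance

/-- The closure `c*_A`: closure in the `*`-representation topology. -/
def cstarClosure (S : Set A) : Set A := @closure A (repTopology A) S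

end Defs

section Compact

variable (A : Type u) [NonUnitalRing A] [StarRing A] [Module ℂ A]
  [IsScalarTower ℂ A A] [SMulCommClass ℂ A A] [StarModule ℂ A]
  [TopologicalSpace A] [IsTopologicalRing A] [ContinuousStar A]

/-- `c*`-compactness in the category of `G*`-algebras: for every `G*`-algebra `Y`, the projection
`A × Y → Y` is `c*`-preserving on subobjects of `A × Y`, i.e. on those `*`-subalgebras which are
`G*`-algebras in the subspace topology. -/
def IsCStarCompact : Prop :=
  ∀ (Y : Type u) [NonUnitalRing Y] [StarRing Y] [Module ℂ Y]
    [IsScalarTower ℂ Y Y] [SMulCommClass ℂ Y Y] [StarModule ℂ Y]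
    [TopologicalSpace Y] [IsTopologicalRing Y] [ContinuousStar Y],
    IsGStar Y → ∀ M : NonUnitalStarSubalgebra ℂ (A × Y), IsGStar M →
      Prod.snd '' cstarClosure (M : Set (A × Y)) = cstarClosure (Prod.snd '' (M : Set (A × Y)))

/-- The variant of `c*`-compactness in which the projections `A × Y → Y` are required to be
`c*`-preserving on all `*`-subalgebras of `A × Y`. -/
def IsCStarCompactAll : Prop :=
  ∀ (Y : Type u) [NonUnitalRing Y] [StarRing Y] [Module ℂ Y]
    [IsScalarTower ℂ Y Y] [SMulCommClass ℂ Y Y] [StarModule ℂ Y]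
    [TopologicalSpace Y] [IsTopologicalRing Y] [ContinuousStar Y],
    IsGStar Y → ∀ M : NonUnitalStarSubalgebra ℂ (A × Y),
      Prod.snd '' cstarClosure (M : Set (A × Y)) = cstarClosure (Prod.snd '' (M : Set (A × Y)))

end Compact

end TopStarAlg

end

/-! In a `G*`-algebra the supremum `γ` is itself a continuous `C*`-seminorm, hence the greatest one.
So `C*(A)` is determined by its `γ`-coordinate, and `α_A` is onto exactly when `A → A_γ` is. Every
continuous representation is bounded by `γ`, and `A_γ` has an isometric representation
(Gelfand–Naimark), so the `*`-representation topology is induced by `A → A_γ`; likewise that of `A ×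
Y` is induced by `A × Y → A_γ × Y_γ`.

If `A → A_γ` is onto, closures can be computed in `C*`-algebras. A `*`-homomorphism of `C*`-algebras
has closed range, so the projection to `Y_γ` carries the closure of a `*`-subalgebra onto the
closure of its image; surjectivity lifts the first coordinate back to `A`.

Conversely, take `Y = A_γ` and let `M` be the graph of `A → A_γ`. Its projection is dense, so
compactness puts, for each `y`, some `(a, y)` in the closure of `M`. The image of `M` in `A_γ × A_γ`
lies in the closed diagonal, so `a` maps to `y`. The graph is a copy of `A`, hence a `G*`-algebra,
so this one test object settles both versions. -/

namespace TopStarAlg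

/-! ### Positive functionals and their GNS representations. -/

section PositiveFunctional

open scoped ComplexOrder

variable {B : Type*} [CStarAlgebra B]

/-- The complex-linear extension of a real functional restricted to self-adjoint parts. -/
noncomputable def complexifyRe (f : B →L[ℝ] ℝ) : B →ₗ[ℂ] ℂ :=
  Module.Dual.extendRCLike
    (f.toLinearMap ∘ₗ (selfAdjoint.submodule ℝ B).subtype ∘ₗ selfAdjointPart ℝ)

theorem complexifyRe_of_isSelfAdjoint (f : B →L[ℝ] ℝ) {a : B} (ha : IsSelfAdjoint a) :
    complexifyRe f a = f a := by
  have h1 : ((selfAdjointPart ℝ a : selfAdjoint B) : B) = a := ha.coe_selfAdjointPart_apply ℝ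
  have h2 : selfAdjointPart ℝ (Complex.I • a) = 0 := by
    ext
    simp [selfAdjointPart_apply_coe, ha.star_eq]
  change ((f (selfAdjointPart ℝ a : selfAdjoint B) : ℝ) : ℂ) -
    Complex.I * (f (selfAdjointPart ℝ (Complex.I • a) : selfAdjoint B) : ℝ) = f a
  rw [h1, h2]
  simp

variable [PartialOrder B] [StarOrderedRing B]

/-- Hahn–Banach: `-(star a * a)` lies outside the closed cone of positive elements, so a real
functional that is nonnegative on the cone is negative there. Its complexification agrees with it on
self-adjoint elements. -/
theorem exists_positive_ne_zero {a : B} (ha : a ≠ 0) :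
    ∃ f : B →ₚ[ℂ] ℂ, f (star a * a) ≠ 0 := by
  have hx : -(star a * a) ∉ ProperCone.positive ℝ B := by
    rw [ProperCone.mem_positive]
    intro h
    have h0 : star a * a = 0 := le_antisymm (neg_nonneg.mp h) (star_mul_self_nonneg a)
    exact ha (CStarRing.star_mul_self_eq_zero_iff a |>.mp h0)
  obtain ⟨f, hf, hfx⟩ := ProperCone.hyperplane_separation_point _ hx
  refine ⟨PositiveLinearMap.mk₀ (complexifyRe f) fun x hx => ?_, ?_⟩
  · rw [complexifyRe_of_isSelfAdjoint f (.of_nonneg hx)]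
    exact_mod_cast hf x hx
  · change complexifyRe f (star a * a) ≠ 0
    rw [complexifyRe_of_isSelfAdjoint f (.star_mul_self a)]
    rw [map_neg] at hfx
    exact_mod_cast (neg_lt_zero.mp hfx).ne'

/-- The operator of `a` sends the class of `1` to a vector of squared norm `f (star a * a)`. -/
theorem exists_gns_ne_zero {a : B} (ha : a ≠ 0) :
    ∃ f : B →ₚ[ℂ] ℂ, f.gnsNonUnitalStarAlgHom a ≠ 0 := by
  obtain ⟨f, hf⟩ := exists_positive_ne_zero ha
  refine ⟨f, fun h => hf ?_⟩
  have h1 : f.gnsNonUnitalStarAlgHom a ((f.toPreGNS 1 : f.PreGNS) : f.GNS) = 0 := by rw [h]; rfl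
  rw [PositiveLinearMap.gnsNonUnitalStarAlgHom_apply_coe] at h1
  have h2 : ‖f.leftMulMapPreGNS a (f.toPreGNS 1)‖ = 0 := by
    rw [← UniformSpace.Completion.norm_coe, h1, norm_zero]
  have h3 := f.preGNS_norm_sq (f.leftMulMapPreGNS a (f.toPreGNS 1))
  rw [h2] at h3
  simpa using h3.symm

end PositiveFunctional

/-! ### Hilbert sums of representations. -/

section DirectSum

variable {ι : Type*} {H : ι → Type*} [∀ i, NormedAddCommGroup (H i)]
  [∀ i, InnerProductSpace ℂ (H i)] [∀ i, CompleteSpace (H i)]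
  {B : Type*} [NonUnitalCStarAlgebra B]

/-- The diagonal operator on a Hilbert sum given by a family of representations. -/
noncomputable def diagOp (π : ∀ i, B →⋆ₙₐ[ℂ] (H i →L[ℂ] H i)) (b : B) :
    lp H 2 →L[ℂ] lp H 2 :=
  -- Coordinatewise domination by `‖b‖ • x` gives both square-summability of the image and the
  -- operator bound.
  have hle : ∀ (x : lp H 2) (i), ‖π i b (x i)‖ ≤ ‖((‖b‖ : ℂ) • x : lp H 2) i‖ := fun x i => by
    rw [lp.coeFn_smul, Pi.smul_apply, norm_smul, Complex.norm_real, norm_norm]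
    exact ((π i b).le_opNorm _).trans
      (mul_le_mul_of_nonneg_right (NonUnitalStarAlgHom.norm_apply_le (π i) b) (norm_nonneg _))
  LinearMap.mkContinuous
    { toFun := fun x => ⟨fun i => π i b (x i), (lp.memℓp ((‖b‖ : ℂ) • x)).mono' (hle x)⟩
      map_add' := fun x y => by ext i; exact map_add (π i b) (x i) (y i)
      map_smul' := fun c x => by ext i; simp } ‖b‖ fun x => by
    refine (lp.norm_mono two_ne_zero (y := (‖b‖ : ℂ) • x) (hle x)).trans ?_
    rw [norm_smul, Complex.norm_real, norm_norm]

theorem diagOp_apply (π : ∀ i, B →⋆ₙₐ[ℂ] (H i →L[ℂ] H i)) (b : B) (x : lp H 2) (i : ι) :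
    diagOp π b x i = π i b (x i) := rfl

/-- The Hilbert sum of a family of representations. -/
noncomputable def directSumRep (π : ∀ i, B →⋆ₙₐ[ℂ] (H i →L[ℂ] H i)) :
    B →⋆ₙₐ[ℂ] (lp H 2 →L[ℂ] lp H 2) where
  toFun := diagOp π
  map_smul' c b := by ext x i; simp [diagOp_apply]
  map_zero' := by ext x i; simp [diagOp_apply]
  map_add' a b := by ext x i; simp [diagOp_apply]
  map_mul' a b := by ext x i; simp [diagOp_apply]
  map_star' b := by
    refine (ContinuousLinearMap.eq_adjoint_iff _ _).mpr fun x y => ?_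
    rw [lp.inner_eq_tsum, lp.inner_eq_tsum]
    refine tsum_congr fun i => ?_
    rw [diagOp_apply, diagOp_apply, StarHomClass.map_star, ContinuousLinearMap.star_eq_adjoint,
      ContinuousLinearMap.adjoint_inner_left]

theorem directSumRep_ne_zero (π : ∀ i, B →⋆ₙₐ[ℂ] (H i →L[ℂ] H i)) {b : B} {i : ι}
    (h : π i b ≠ 0) : directSumRep π b ≠ 0 := by
  classical
  intro h0
  refine h (ContinuousLinearMap.ext fun v => ?_)
  have h1 : diagOp π b (lp.single 2 i v) i = 0 := by
    change directSumRep π b (lp.single 2 i v) i = 0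
    rw [h0]; rfl
  simpa [diagOp_apply] using h1

end DirectSum

open scoped ComplexOrder in
/-- The Gelfand–Naimark theorem. -/
theorem exists_isometric_rep (B : Type u) [NonUnitalCStarAlgebra B] :
    ∃ (H : Type u) (_ : NormedAddCommGroup H) (_ : InnerProductSpace ℂ H) (_ : CompleteSpace H)
      (π : B →⋆ₙₐ[ℂ] (H →L[ℂ] H)), Isometry π := by
  let _ := CStarAlgebra.spectralOrder (Unitization ℂ B)
  let _ := CStarAlgebra.spectralOrderedRing (Unitization ℂ B)
  -- The unitization supplies the vector `1`; summing over all positive functionals makes the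
  -- representation faithful, and an injective `*`-homomorphism of `C*`-algebras is isometric.
  let ρ := directSumRep fun f : Unitization ℂ B →ₚ[ℂ] ℂ => f.gnsNonUnitalStarAlgHom
  have hρ : Function.Injective ρ := by
    rw [injective_iff_map_eq_zero]
    intro a ha
    by_contra hne
    obtain ⟨f, hf⟩ := exists_gns_ne_zero hne
    exact directSumRep_ne_zero _ hf ha
  exact ⟨lp (fun f : Unitization ℂ B →ₚ[ℂ] ℂ => f.GNS) 2, inferInstance, inferInstance,
    inferInstance, ρ.comp (Unitization.inrNonUnitalStarAlgHom ℂ B),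
    NonUnitalStarAlgHom.isometry _ (hρ.comp Unitization.inr_injective)⟩

/-! ### Closed range of `*`-homomorphisms between `C*`-algebras. -/

section ClosedRange

variable {B C : Type*} [NonUnitalCStarAlgebra B] [NonUnitalCStarAlgebra C]

/-- With `c = star b * b` and `x = cfcₙ g c`, the left side is `star (b - b * x) * (b - b * x)`, so
its norm can be read off a scalar function. -/
theorem compress_eq_cfcₙ {c : B} (hc : IsSelfAdjoint c) {g : ℝ → ℝ} (hg : Continuous g)
    (hg0 : g 0 = 0) :
    c - c * cfcₙ g c - (cfcₙ g c * c - cfcₙ g c * c * cfcₙ g c) =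
      cfcₙ (fun t => t - t * g t - (g t * t - g t * t * g t)) c := by
  have hid : cfcₙ (fun t : ℝ => t) c = c := cfcₙ_id' ℝ c
  have e1 : cfcₙ (fun t => t * g t) c = c * cfcₙ g c := by
    rw [cfcₙ_mul (fun t : ℝ => t) g c, hid]
  have e2 : cfcₙ (fun t => g t * t) c = cfcₙ g c * c := by
    rw [cfcₙ_mul g (fun t : ℝ => t) c, hid]
  have e3 : cfcₙ (fun t => g t * t * g t) c = cfcₙ g c * c * cfcₙ g c := by
    rw [cfcₙ_mul (fun t => g t * t) g c, e2]
  rw [cfcₙ_sub (fun t => t - t * g t) (fun t => g t * t - g t * t * g t) c,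
    cfcₙ_sub (fun t : ℝ => t) (fun t => t * g t) c,
    cfcₙ_sub (fun t => g t * t) (fun t => g t * t * g t) c, hid, e1, e2, e3]

/-- Functional calculus cuts the singular values of `b` down to at most `r = ‖φ b‖`. The image does
not change, since those of `φ b` are already at most `r`. -/
theorem exists_lift_norm_le (φ : B →⋆ₙₐ[ℂ] C) (b : B) :
    ∃ b' : B, φ b' = φ b ∧ ‖b'‖ ≤ ‖φ b‖ := by
  set r : ℝ := ‖φ b‖ with hr
  have hr0 : 0 ≤ r := norm_nonneg _
  rcases hr0.eq_or_lt with h0 | hpos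
  · exact ⟨0, by rw [map_zero, eq_comm, ← norm_eq_zero, ← hr, h0], by simpa using hr0⟩
  let _ := CStarAlgebra.spectralOrder B
  let _ := CStarAlgebra.spectralOrderedRing B
  -- The factor `1 - g t` turns `√t` into `min (√t) r`. Since `g 0 = 0`, the non-unital calculus
  -- applies; `g` vanishes for `t ≤ r ^ 2`, hence on the spectrum of `φ c`.
  let g : ℝ → ℝ := fun t => 1 - (max 1 (√t / r))⁻¹
  have hm : ∀ t : ℝ, 0 < max 1 (√t / r) := fun t => lt_max_of_lt_left one_pos
  have hgc : Continuous g := by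
    refine continuous_const.sub (Continuous.inv₀ (by fun_prop) fun t => (hm t).ne')
  have hg0 : g 0 = 0 := by simp [g]
  set c := star b * b with hc
  have hcs : IsSelfAdjoint c := .star_mul_self b
  set x := cfcₙ g c with hx
  have hxs : IsSelfAdjoint x := cfcₙ_predicate g c
  refine ⟨b - b * x, ?_, ?_⟩
  · have h1 : φ x = 0 := by
      rw [hx, NonUnitalStarAlgHom.map_cfcₙ φ g c hgc.continuousOn hg0
        (AddMonoidHomClass.continuous_of_bound φ 1 fun b => by
          simpa using NonUnitalStarAlgHom.norm_apply_le φ b) hcs (hcs.map φ), ← cfcₙ_zero ℝ (φ c)]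
      refine cfcₙ_congr fun t ht => ?_
      have h2 : t ≤ r ^ 2 := by
        have h3 : ‖t‖ ≤ ‖φ c‖ := by
          simpa [cfcₙ_id' ℝ (φ c) (hcs.map φ)] using
            norm_apply_le_norm_cfcₙ (fun t : ℝ => t) (φ c) ht continuous_id.continuousOn rfl
              (hcs.map φ)
        rw [hc, map_mul, StarHomClass.map_star, CStarRing.norm_star_mul_self, ← sq] at h3
        exact (le_abs_self t).trans h3
      have h4 : √t / r ≤ 1 := (div_le_one hpos).mpr ((Real.sqrt_le_left hr0).mpr h2)
      simp [g, max_eq_left h4]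
    rw [map_sub, map_mul, h1, mul_zero, sub_zero]
  · have h1 : star (b - b * x) * (b - b * x) = c - c * x - (x * c - x * c * x) := by
      rw [star_sub, star_mul, hxs.star_eq, hc]
      noncomm_ring
    have h2 := compress_eq_cfcₙ hcs hgc hg0
    rw [← hx] at h2
    have h3 : ‖star (b - b * x) * (b - b * x)‖ ≤ r ^ 2 := by
      rw [h1, h2]
      refine norm_cfcₙ_le fun t ht => ?_
      have ht0 : 0 ≤ t := quasispectrum_nonneg_of_nonneg c (star_mul_self_nonneg b) t ht
      have h4 : t - t * g t - (g t * t - g t * t * g t) = (√t / max 1 (√t / r)) ^ 2 := by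
        rw [div_pow, Real.sq_sqrt ht0]
        simp only [g]
        field_simp
        ring
      rw [h4, Real.norm_of_nonneg (sq_nonneg _)]
      refine pow_le_pow_left₀ (div_nonneg (Real.sqrt_nonneg _) (hm t).le) ?_ 2
      rw [div_le_iff₀ (hm t)]
      exact (div_le_iff₀' hpos).mp (le_max_right _ _)
    rw [CStarRing.norm_star_mul_self, ← sq] at h3
    exact (sq_le_sq₀ (norm_nonneg _) hr0).mp h3

/-- Lifts without increase of norm let a convergent series in the range be lifted termwise to an
absolutely convergent one in the complete algebra `B`. -/
theorem isClosed_range_starAlgHom (φ : B →⋆ₙₐ[ℂ] C) : IsClosed (Set.range φ) := by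
  let f : NormedAddGroupHom B C :=
    (φ : B →+ C).mkNormedAddGroupHom 1 fun b => by
      simpa using NonUnitalStarAlgHom.norm_apply_le φ b
  have hf : f.SurjectiveOnWith (φ : B →+ C).range 1 := by
    rintro _ ⟨b, rfl⟩
    obtain ⟨b', h1, h2⟩ := exists_lift_norm_le φ b
    exact ⟨b', h1, by simpa using h2⟩
  have := controlled_closure_of_complete one_pos one_pos hf
  refine isClosed_of_closure_subset fun c hc => ?_
  obtain ⟨b, hb, -⟩ := this c hc
  exact ⟨b, hb⟩

end ClosedRange

open CompletionAt

/-! ### Continuous `C*`-seminorms and the greatest one. -/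

section Seminorms

variable {X Y : Type u} [NonUnitalRing X] [StarRing X] [Module ℂ X] [TopologicalSpace X]
  [NonUnitalRing Y] [StarRing Y] [Module ℂ Y] [TopologicalSpace Y]

/-- The pullback of a continuous `C*`-seminorm along a continuous `*`-homomorphism. -/
noncomputable def ContCStarSeminorm.comap (p : ContCStarSeminorm Y) (φ : X →⋆ₙₐ[ℂ] Y) (hφ : Continuous φ) :
    ContCStarSeminorm X where
  toSeminorm := p.toSeminorm.comp (φ : X →ₗ[ℂ] Y)
  mul_le' a b := by
    change p (φ (a * b)) ≤ p (φ a) * p (φ b)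
    rw [map_mul]
    exact p.mul_le' _ _
  cstar' a := by
    change p (φ (star a * a)) = p (φ a) ^ 2
    rw [map_mul, StarHomClass.map_star]
    exact p.cstar' _
  continuous' := p.continuous'.comp hφ

theorem ContCStarSeminorm.comap_apply (p : ContCStarSeminorm Y) (φ : X →⋆ₙₐ[ℂ] Y)
    (hφ : Continuous φ) (x : X) : p.comap φ hφ x = p (φ x) := rfl

/-- The norm of a `C*`-algebra. -/
noncomputable def normCStarSeminorm (B : Type u) [NonUnitalCStarAlgebra B] :
    ContCStarSeminorm B where
  toSeminorm := normSeminorm ℂ B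
  mul_le' := norm_mul_le
  cstar' a := by
    change ‖star a * a‖ = ‖a‖ ^ 2
    rw [CStarRing.norm_star_mul_self, sq]
  continuous' := continuous_norm

theorem normCStarSeminorm_apply {B : Type u} [NonUnitalCStarAlgebra B] (b : B) :
    normCStarSeminorm B b = ‖b‖ := rfl

instance : Nonempty (ContCStarSeminorm X) :=
  ⟨{ toSeminorm := 0
     mul_le' := fun _ _ => by simp
     cstar' := fun _ => by simp
     continuous' := continuous_const }⟩

theorem isGStar_of_forall_le (q : ContCStarSeminorm X)
    (hq : ∀ (p : ContCStarSeminorm X) (x : X), p x ≤ q x) : IsGStar X := by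
  have hg : gamma X = fun x => q x := funext fun x =>
    le_antisymm (ciSup_le fun p => hq p x)
      (le_ciSup (f := fun p : ContCStarSeminorm X => p x)
        ⟨q x, Set.forall_mem_range.mpr fun p => hq p x⟩ q)
  refine ⟨fun x => ⟨q x, Set.forall_mem_range.mpr fun p => hq p x⟩, ?_⟩
  rw [hg]
  exact q.continuous'

theorem IsGStar.le_gamma (hX : IsGStar X) (p : ContCStarSeminorm X) (x : X) : p x ≤ gamma X x :=
  le_ciSup (f := fun p : ContCStarSeminorm X => p x) (hX.1 x) p

theorem gamma_nonneg (x : X) : 0 ≤ gamma X x :=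
  Real.iSup_nonneg fun p => apply_nonneg p.toSeminorm x

/-- In a `G*`-algebra, `γ` is the greatest continuous `C*`-seminorm. -/
noncomputable def IsGStar.gammaSeminorm (hX : IsGStar X) : ContCStarSeminorm X where
  toSeminorm := Seminorm.of (gamma X)
    (fun x y => ciSup_le fun p => (map_add_le_add p.toSeminorm x y).trans
      (add_le_add (hX.le_gamma p x) (hX.le_gamma p y)))
    (fun c x => by
      simp only [gamma, map_smul_eq_mul]
      exact (Real.mul_iSup_of_nonneg (norm_nonneg c) _).symm)
  mul_le' x y := ciSup_le fun p => (p.mul_le' x y).trans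
    (mul_le_mul (hX.le_gamma p x) (hX.le_gamma p y) (apply_nonneg _ _) (gamma_nonneg x))
  cstar' x := by
    change gamma X (star x * x) = gamma X x ^ 2
    refine le_antisymm (ciSup_le fun p => ?_) ?_
    · rw [p.cstar']
      exact pow_le_pow_left₀ (apply_nonneg _ _) (hX.le_gamma p x) 2
    -- For each `p`, `p x ^ 2 = p (star x * x) ≤ γ (star x * x)`; take square roots before the
    -- supremum.
    · refine (Real.le_sqrt (gamma_nonneg _) (gamma_nonneg _)).mp (ciSup_le fun p => ?_)
      refine Real.le_sqrt_of_sq_le ?_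
      rw [← p.cstar']
      exact hX.le_gamma p _
  continuous' := hX.2

theorem IsGStar.le_gammaSeminorm (hX : IsGStar X) (p : ContCStarSeminorm X) :
    p ≤ hX.gammaSeminorm := hX.le_gamma p

theorem norm_ofHom (p : ContCStarSeminorm X) (x : X) : ‖ofHom p x‖ = p x := norm_of p x

theorem denseRange_ofHom (p : ContCStarSeminorm X) : DenseRange (ofHom p) :=
  (isDenseInducing_of p).dense

theorem continuous_ofHom [IsTopologicalRing X] (p : ContCStarSeminorm X) :
    Continuous (ofHom p) := by
  refine continuous_of_continuousAt_zero (ofHom p) ?_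
  rw [ContinuousAt, map_zero, tendsto_zero_iff_norm_tendsto_zero]
  simp only [norm_ofHom]
  simpa using p.continuous'.tendsto 0

/-- The map `B → B_p` is a `*`-homomorphism of `C*`-algebras, hence contractive, so the norm
dominates every `p`. -/
theorem isGStar_of_cstarAlgebra (B : Type u) [NonUnitalCStarAlgebra B] : IsGStar B := by
  refine isGStar_of_forall_le (normCStarSeminorm B) fun p b => ?_
  rw [← norm_ofHom p b, normCStarSeminorm_apply]
  exact NonUnitalStarAlgHom.norm_apply_le (ofHom p) b

end Seminorms

/-! ### The enveloping algebra through its top coordinate. -/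

section Alpha

variable {A : Type u} [NonUnitalRing A] [StarRing A] [Module ℂ A] [TopologicalSpace A]

theorem transFun_self (p : ContCStarSeminorm A) (z : CompletionAt p) : transFun p p z = z := by
  induction z using ind with
  | hc => exact isClosed_eq (continuous_transFun (p := p) (q := p)) continuous_id
  | h a => exact transFun_of (fun _ => le_rfl) a

/-- Since `γ` is the greatest element of `N(A)`, a compatible family is determined by its
`γ`-coordinate, and any element of `A_γ` extends to a family through the transition maps. -/
theorem IsGStar.alpha_surjective_iff (hA : IsGStar A) :
    Function.Surjective (alpha A) ↔ Function.Surjective (ofHom hA.gammaSeminorm) := by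
  constructor
  · intro h z
    obtain ⟨a, ha⟩ := h ⟨fun p => transition (hA.le_gammaSeminorm p) z, fun p q hpq => by
      change transFun p q (transFun q _ z) = transFun p _ z
      induction z using ind with
      | hc =>
        exact isClosed_eq (continuous_transFun.comp continuous_transFun) continuous_transFun
      | h a =>
        rw [transFun_of (hA.le_gammaSeminorm q), transFun_of (hA.le_gammaSeminorm p)]
        exact transFun_of hpq a⟩
    refine ⟨a, ?_⟩
    have h1 : ofHom hA.gammaSeminorm a = transFun _ _ z :=
      congrFun (congrArg Subtype.val ha) hA.gammaSeminorm
    rw [h1, transFun_self]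
  · intro h x
    obtain ⟨a, ha⟩ := h (x.1 hA.gammaSeminorm)
    refine ⟨a, Subtype.ext (funext fun p => ?_)⟩
    change ofHom p a = x.1 p
    rw [← x.2 p _ (hA.le_gammaSeminorm p), ← ha, transition_ofHom]

end Alpha

/-! ### The `*`-representation topology as an induced topology. -/

section RepTopology

variable {X Y : Type u} [NonUnitalRing X] [StarRing X] [Module ℂ X] [TopologicalSpace X]
  [NonUnitalRing Y] [StarRing Y] [Module ℂ Y] [TopologicalSpace Y]
  {B C : Type u} [NonUnitalCStarAlgebra B] [NonUnitalCStarAlgebra C]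

/-- A continuous `*`-homomorphism to a `C*`-algebra whose norm bounds every representation. -/
def DominatesReps (φ : X →⋆ₙₐ[ℂ] B) : Prop :=
  Continuous φ ∧ ∃ K : ℝ, ∀ (H : Type u) [NormedAddCommGroup H] [InnerProductSpace ℂ H]
    [CompleteSpace H] (π : X →⋆ₙₐ[ℂ] (H →L[ℂ] H)), Continuous π → ∀ x, ‖π x‖ ≤ K * ‖φ x‖

/-- One inequality composes `φ` with an isometric representation of `B`; the other is the norm bound
on each representation. -/
theorem DominatesReps.repTopology_eq {φ : X →⋆ₙₐ[ℂ] B} (hφ : DominatesReps φ) :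
    repTopology X = TopologicalSpace.induced φ inferInstance := by
  obtain ⟨hc, K, hK⟩ := hφ
  refine le_antisymm ?_ ?_
  · obtain ⟨H, i1, i2, i3, ρ, hρ⟩ := exists_isometric_rep B
    rw [hρ.isUniformInducing.isInducing.eq_induced, induced_compose]
    exact iInf_le_of_le H <| iInf_le_of_le i1 <| iInf_le_of_le i2 <| iInf_le_of_le i3 <|
      iInf_le_of_le (ρ.comp φ) <| iInf_le_of_le (hρ.continuous.comp hc) le_rfl
  · refine le_iInf fun H => le_iInf fun i1 => le_iInf fun i2 => le_iInf fun i3 =>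
      le_iInf fun π => le_iInf fun hπ => ?_
    rw [← continuous_iff_le_induced]
    -- For the seminorm pulled back along `φ`, whose topology is the induced one, the bound by `K`
    -- is continuity.
    let _ : SeminormedAddCommGroup X := SeminormedAddCommGroup.induced X B φ
    exact AddMonoidHomClass.continuous_of_bound π K fun x => hK H π hπ x

theorem DominatesReps.mem_cstarClosure_iff {φ : X →⋆ₙₐ[ℂ] B} (hφ : DominatesReps φ) {S : Set X}
    {x : X} : x ∈ cstarClosure S ↔ φ x ∈ closure (φ '' S) := by
  rw [cstarClosure, hφ.repTopology_eq, closure_induced]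

/-- Split `(x, y) = (x, 0) + (0, y)` and restrict the representation to each factor. The two bounds
add up, which is why domination allows a constant; absolute values are taken because `K` and `L`
carry no sign. -/
theorem DominatesReps.prodMap {φ : X →⋆ₙₐ[ℂ] B} {ψ : Y →⋆ₙₐ[ℂ] C} (hφ : DominatesReps φ)
    (hψ : DominatesReps ψ) :
    DominatesReps ((φ.comp (NonUnitalStarAlgHom.fst ℂ X Y)).prod
      (ψ.comp (NonUnitalStarAlgHom.snd ℂ X Y))) := by
  obtain ⟨hc, K, hK⟩ := hφ
  obtain ⟨hd, L, hL⟩ := hψ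
  refine ⟨(hc.comp continuous_fst).prodMk (hd.comp continuous_snd), |K| + |L|,
    fun H _ _ _ π hπ z => ?_⟩
  have h1 := hK H (π.comp (NonUnitalStarAlgHom.inl ℂ X Y))
    (hπ.comp (continuous_id.prodMk continuous_const)) z.1
  have h2 := hL H (π.comp (NonUnitalStarAlgHom.inr ℂ X Y))
    (hπ.comp (continuous_const.prodMk continuous_id)) z.2
  have h3 : π z = π (z.1, 0) + π (0, z.2) := by rw [← map_add]; simp
  change ‖π (z.1, 0)‖ ≤ _ at h1
  change ‖π (0, z.2)‖ ≤ _ at h2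
  change ‖π z‖ ≤ (|K| + |L|) * max ‖φ z.1‖ ‖ψ z.2‖
  rw [h3, add_mul]
  refine (norm_add_le _ _).trans (add_le_add (h1.trans ?_) (h2.trans ?_))
  · exact mul_le_mul (le_abs_self K) (le_max_left _ _) (norm_nonneg _) (abs_nonneg K)
  · exact mul_le_mul (le_abs_self L) (le_max_right _ _) (norm_nonneg _) (abs_nonneg L)

theorem dominatesReps_id : DominatesReps (NonUnitalStarAlgHom.id ℂ B) :=
  ⟨continuous_id, 1, fun H _ _ _ π _ x => by
    simpa using NonUnitalStarAlgHom.norm_apply_le π x⟩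

/-- The operator norm of a continuous representation is a continuous `C*`-seminorm, so it lies below
`γ`. -/
theorem IsGStar.dominatesReps [IsTopologicalRing X] [IsScalarTower ℂ X X] [SMulCommClass ℂ X X]
    [StarModule ℂ X] (hX : IsGStar X) : DominatesReps (ofHom hX.gammaSeminorm) :=
  ⟨continuous_ofHom _, 1, fun H _ _ _ π hπ x => by
    rw [one_mul, norm_ofHom]
    exact hX.le_gamma ((normCStarSeminorm (H →L[ℂ] H)).comap π hπ) x⟩

end RepTopology

/-! ### Compactness and surjectivity. -/

section Compactness

variable {A : Type u} [NonUnitalRing A] [StarRing A] [Module ℂ A] [TopologicalSpace A]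

/-- A `*`-homomorphism of `C*`-algebras maps closures of `*`-subalgebras onto closures. -/
theorem image_closure_starSubalgebra {B C : Type*} [NonUnitalCStarAlgebra B]
    [NonUnitalCStarAlgebra C] (φ : B →⋆ₙₐ[ℂ] C) (S : NonUnitalStarSubalgebra ℂ B) :
    φ '' closure (S : Set B) = closure (φ '' (S : Set B)) := by
  have hc : Continuous φ := AddMonoidHomClass.continuous_of_bound φ 1 fun b => by
    simpa using NonUnitalStarAlgHom.norm_apply_le φ b
  refine (image_closure_subset_closure_image hc).antisymm ?_
  have : IsClosed (S.topologicalClosure : Set B) := S.isClosed_topologicalClosure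
  -- The closure of `S` is itself a `C*`-algebra, so the closed range theorem applies to the
  -- restriction of `φ` to it.
  have h := isClosed_range_starAlgHom
    (φ.comp (NonUnitalStarSubalgebraClass.subtype S.topologicalClosure))
  have hr : Set.range (φ.comp (NonUnitalStarSubalgebraClass.subtype S.topologicalClosure)) =
      φ '' closure (S : Set B) := by
    ext c
    constructor
    · rintro ⟨b, rfl⟩
      exact ⟨b, b.2, rfl⟩
    · rintro ⟨b, hb, rfl⟩
      exact ⟨⟨b, hb⟩, rfl⟩
  rw [hr] at h
  exact closure_minimal (Set.image_mono subset_closure) h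

/-- The graph of a `*`-homomorphism. -/
def starGraph {X Y : Type*} [NonUnitalRing X] [StarRing X] [Module ℂ X] [NonUnitalRing Y]
    [StarRing Y] [Module ℂ Y] (φ : X →⋆ₙₐ[ℂ] Y) : NonUnitalStarSubalgebra ℂ (X × Y) where
  carrier := {z | φ z.1 = z.2}
  add_mem' {a b} ha hb := by
    rw [Set.mem_ofPred_eq] at *
    simp [ha, hb]
  zero_mem' := by simp
  mul_mem' {a b} ha hb := by
    rw [Set.mem_ofPred_eq] at *
    simp [ha, hb]
  smul_mem' c a ha := by
    rw [Set.mem_ofPred_eq] at *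
    simp [ha]
  star_mem' {a} ha := by
    rw [Set.mem_ofPred_eq] at *
    simp [ha, StarHomClass.map_star]

/-- Continuity of `φ` makes `a ↦ (a, φ a)` continuous, so every seminorm on the graph pulls back to
`A` and is bounded there by `γ`. -/
theorem IsGStar.starGraph (hA : IsGStar A) {Y : Type u} [NonUnitalRing Y] [StarRing Y]
    [Module ℂ Y] [TopologicalSpace Y] {φ : A →⋆ₙₐ[ℂ] Y} (hφ : Continuous φ) :
    IsGStar (starGraph φ) := by
  let e : A →⋆ₙₐ[ℂ] TopStarAlg.starGraph φ :=
    { toFun := fun a => ⟨(a, φ a), rfl⟩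
      map_smul' := fun c a => Subtype.ext (Prod.ext rfl (map_smul φ c a))
      map_zero' := Subtype.ext (Prod.ext rfl (map_zero φ))
      map_add' := fun a b => Subtype.ext (Prod.ext rfl (map_add φ a b))
      map_mul' := fun a b => Subtype.ext (Prod.ext rfl (map_mul φ a b))
      map_star' := fun a => Subtype.ext (Prod.ext rfl (StarHomClass.map_star φ a)) }
  have he : Continuous e := (continuous_id.prodMk hφ).subtype_mk _
  refine isGStar_of_forall_le (hA.gammaSeminorm.comap
    ((NonUnitalStarAlgHom.fst ℂ A Y).comp
      (NonUnitalStarSubalgebraClass.subtype (TopStarAlg.starGraph φ)))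
    (continuous_fst.comp continuous_subtype_val)) fun p z => ?_
  have hz : e z.1.1 = z := Subtype.ext (Prod.ext rfl z.2)
  have h := hA.le_gamma (p.comap e he) z.1.1
  rw [ContCStarSeminorm.comap_apply, hz] at h
  exact h

variable [IsScalarTower ℂ A A] [SMulCommClass ℂ A A] [StarModule ℂ A] [IsTopologicalRing A]

theorem IsGStar.isCStarCompactAll (hA : IsGStar A)
    (hs : Function.Surjective (ofHom hA.gammaSeminorm)) : IsCStarCompactAll A := by
  intro Y _ _ _ _ _ _ _ _ _ hY M
  let φ := ofHom hA.gammaSeminorm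
  let ψ := ofHom hY.gammaSeminorm
  let J := (φ.comp (NonUnitalStarAlgHom.fst ℂ A Y)).prod (ψ.comp (NonUnitalStarAlgHom.snd ℂ A Y))
  have hJ : DominatesReps J := hA.dominatesReps.prodMap hY.dominatesReps
  have key : Prod.snd '' closure (J '' (M : Set (A × Y))) =
      closure (ψ '' (Prod.snd '' (M : Set (A × Y)))) := by
    have h := image_closure_starSubalgebra
      (NonUnitalStarAlgHom.snd ℂ (CompletionAt hA.gammaSeminorm) (CompletionAt hY.gammaSeminorm))
      (M.map J)
    rw [NonUnitalStarSubalgebra.coe_map] at h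
    refine h.trans ?_
    rw [Set.image_image, Set.image_image]
    rfl
  ext y
  rw [hY.dominatesReps.mem_cstarClosure_iff, ← key]
  constructor
  · rintro ⟨z, hz, rfl⟩
    exact ⟨J z, hJ.mem_cstarClosure_iff.mp hz, rfl⟩
  · rintro ⟨⟨b, c⟩, hd, rfl⟩
    -- The only use of surjectivity: the point found in the completion must come from `A × Y`.
    obtain ⟨a, rfl⟩ := hs b
    exact ⟨(a, y), hJ.mem_cstarClosure_iff.mpr hd, rfl⟩

theorem IsCStarCompact.surjective_ofHom (hA : IsGStar A) (h : IsCStarCompact A) :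
    Function.Surjective (ofHom hA.gammaSeminorm) := by
  intro y
  let φ := ofHom hA.gammaSeminorm
  have hφ : Continuous φ := continuous_ofHom _
  have hB := dominatesReps_id (B := CompletionAt hA.gammaSeminorm)
  have hy : y ∈ cstarClosure (Prod.snd '' (starGraph φ : Set (A × CompletionAt _))) := by
    rw [hB.mem_cstarClosure_iff]
    refine closure_mono ?_ (denseRange_ofHom hA.gammaSeminorm y)
    rintro _ ⟨a, rfl⟩
    exact ⟨φ a, ⟨(a, φ a), rfl, rfl⟩, rfl⟩
  rw [← h (CompletionAt hA.gammaSeminorm) (isGStar_of_cstarAlgebra _) (starGraph φ)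
    (hA.starGraph hφ)] at hy
  obtain ⟨⟨a, y⟩, hz, rfl⟩ := hy
  rw [(hA.dominatesReps.prodMap hB).mem_cstarClosure_iff] at hz
  -- On the graph the map into the product of completions takes the values `(φ a, φ a)`, so the
  -- closure of the image stays in the diagonal.
  have hcl : IsClosed {w : CompletionAt hA.gammaSeminorm × CompletionAt hA.gammaSeminorm |
      w.1 = w.2} := isClosed_eq continuous_fst continuous_snd
  refine ⟨a, closure_minimal ?_ hcl hz⟩
  rintro _ ⟨w, hw, rfl⟩
  exact hw

end Compactness

end TopStarAlg

theorem mainTheorem12 (A : Type u) [NonUnitalRing A] [StarRing A] [Module ℂ A]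
    [IsScalarTower ℂ A A] [SMulCommClass ℂ A A] [StarModule ℂ A]
    [TopologicalSpace A] [IsTopologicalRing A] [ContinuousStar A]
    (hA : TopStarAlg.IsGStar A) :
    (TopStarAlg.IsCStarCompact A ↔ Function.Surjective (TopStarAlg.alpha A)) ∧
      (TopStarAlg.IsCStarCompactAll A ↔ Function.Surjective (TopStarAlg.alpha A)) := by
  rw [hA.alpha_surjective_iff]
  have hAll : TopStarAlg.IsCStarCompactAll A → TopStarAlg.IsCStarCompact A :=
    fun h Y _ _ _ _ _ _ _ _ _ hY M _ => h Y hY M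
  exact ⟨⟨fun h => h.surjective_ofHom hA, fun h => hAll (hA.isCStarCompactAll h)⟩,
    ⟨fun h => (hAll h).surjective_ofHom hA, hA.isCStarCompactAll⟩⟩
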